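/- Let $m,n\ge 1$ and let $A=(a_{ij})$ be a random real $m\times n$ matrix whose entries are independent random variables, each having a probability density function that is even ($f(-x)=f(x)$); the entries need not be identically distributed. Regard $A$ as the payoff matrix of a two-person zero-sum game in which the column player pays $a_{ij}$ to the row player when row $i$ and column $j$ are chosen. Its value is $$V(A)=\max_{p}\min_{q}\,p^{t}Aq=\min_{q}\max_{p}\,p^{t}Aq ,$$ where $p$ and $q$ range over the probability vectors in $\mathbf R^m$ and $\mathbf R^n$; the game favors the row player when $V(A)>0$. For $N,d\ge 1$ let $p(N,d)$ denote the probability that the convex hull of $N$ random points in $\mathbf R^d$ does not contain the origin, where the points are independent and each has a density function that is symmetric with respect to the origin ($f(-z)=f(z)$); the points need not be identically distributed. Then $$\mathrm P\big(V(A)>0\big)=p(m+n,m)=\frac{1}{2^{\,m+n-1}}\sum_{j=0}^{m-1}\binom{m+n-1}{j}.$$ In particular $p(m+n,m)$ does not depend on the choice of the symmetric densities. -/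

import Mathlib

open MeasureTheory ProbabilityTheory

/-- The expected payoff `pᵗ A q = ∑ i j, p i * A i j * q j` to the row player in the zero-sum game
with payoff matrix `A`, when the players use the mixed strategies `p` (rows), `q` (columns). -/
def expectedPayoff {m n : ℕ} (A : Matrix (Fin m) (Fin n) ℝ) (p : Fin m → ℝ) (q : Fin n → ℝ) : ℝ :=
  ∑ i, ∑ j, p i * A i j * q j

/-- The value `max_p min_q pᵗ A q` of the zero-sum game with payoff matrix `A`, where `p` and `q`
range over the mixed strategies (probability vectors) of the row and of the column player. -/
noncomputable def gameValue {m n : ℕ} (A : Matrix (Fin m) (Fin n) ℝ) : ℝ :=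
  ⨆ p : stdSimplex ℝ (Fin m), ⨅ q : stdSimplex ℝ (Fin n), expectedPayoff A p q

/-- The minimax theorem: if both players have at least one pure strategy, there are optimal mixed
strategies `p₀`, `q₀`, and their payoff is both `max_p min_q pᵗ A q` and `min_q max_p pᵗ A q`.
So `gameValue` is the value of the game, with all extrema attained. -/
theorem gameValue_minimax {m n : ℕ} (hm : 0 < m) (hn : 0 < n) (A : Matrix (Fin m) (Fin n) ℝ) :
    ∃ (p₀ : stdSimplex ℝ (Fin m)) (q₀ : stdSimplex ℝ (Fin n)),
      (∀ q : stdSimplex ℝ (Fin n), gameValue A ≤ expectedPayoff A p₀ q) ∧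
      (∀ p : stdSimplex ℝ (Fin m), expectedPayoff A p q₀ ≤ gameValue A) ∧
      expectedPayoff A p₀ q₀ = gameValue A ∧
      gameValue A = ⨅ q : stdSimplex ℝ (Fin n), ⨆ p : stdSimplex ℝ (Fin m),
        expectedPayoff A p q := by
  have : Nonempty (Fin m) := ⟨⟨0, hm⟩⟩
  have : Nonempty (Fin n) := ⟨⟨0, hn⟩⟩
  have hc : Continuous fun z : (Fin m → ℝ) × (Fin n → ℝ) => expectedPayoff A z.1 z.2 := by
    unfold expectedPayoff; fun_prop
  have hadd1 : ∀ (q : Fin n → ℝ) (p p' : Fin m → ℝ) (a b : ℝ),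
      expectedPayoff A (a • p + b • p') q = a * expectedPayoff A p q + b * expectedPayoff A p' q := by
    intro q p p' a b
    simp only [expectedPayoff, Finset.mul_sum, ← Finset.sum_add_distrib, Pi.add_apply,
      Pi.smul_apply, smul_eq_mul]
    exact Finset.sum_congr rfl fun i _ => Finset.sum_congr rfl fun j _ => by ring
  have hadd2 : ∀ (p : Fin m → ℝ) (q q' : Fin n → ℝ) (a b : ℝ),
      expectedPayoff A p (a • q + b • q') = a * expectedPayoff A p q + b * expectedPayoff A p q' := by
    intro q p p' a b
    simp only [expectedPayoff, Finset.mul_sum, ← Finset.sum_add_distrib, Pi.add_apply,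
      Pi.smul_apply, smul_eq_mul]
    exact Finset.sum_congr rfl fun i _ => Finset.sum_congr rfl fun j _ => by ring
  obtain ⟨q₀, hq₀, p₀, hp₀, hs⟩ := Sion.exists_isSaddlePointOn
    (X := stdSimplex ℝ (Fin n)) (Y := stdSimplex ℝ (Fin m))
    (f := fun q p => expectedPayoff A p q)
    ⟨_, single_mem_stdSimplex ℝ (⟨0, hn⟩ : Fin n)⟩ (convex_stdSimplex ℝ _)
    (isCompact_stdSimplex ℝ _)
    (fun p _ => (Continuous.lowerSemicontinuous
      (hc.comp (continuous_const.prodMk continuous_id))).lowerSemicontinuousOn _)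
    (fun p _ => ConvexOn.quasiconvexOn ⟨convex_stdSimplex ℝ _, fun x _ y _ a b _ _ _ => by
      simp [hadd2]⟩)
    (convex_stdSimplex ℝ _)
    ⟨_, single_mem_stdSimplex ℝ (⟨0, hm⟩ : Fin m)⟩
    (isCompact_stdSimplex ℝ _)
    (fun q _ => (Continuous.upperSemicontinuous
      (hc.comp (continuous_id.prodMk continuous_const))).upperSemicontinuousOn _)
    (fun p _ => ConcaveOn.quasiconcaveOn ⟨convex_stdSimplex ℝ _, fun x _ y _ a b _ _ _ => by
      simp [hadd1]⟩)
  have : Nonempty (stdSimplex ℝ (Fin n)) := ⟨⟨q₀, hq₀⟩⟩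
  have : Nonempty (stdSimplex ℝ (Fin m)) := ⟨⟨p₀, hp₀⟩⟩
  have hs' : ∀ (q : stdSimplex ℝ (Fin n)) (p : stdSimplex ℝ (Fin m)),
      expectedPayoff A p q₀ ≤ expectedPayoff A p₀ q := fun q p => hs q q.2 p p.2
  have hb1 : ∀ p : stdSimplex ℝ (Fin m), BddBelow (Set.range fun q : stdSimplex ℝ (Fin n) =>
      expectedPayoff A p q) := fun p =>
    (isCompact_range (hc.comp (continuous_const.prodMk continuous_subtype_val))).bddBelow
  have hb2 : ∀ q : stdSimplex ℝ (Fin n), BddAbove (Set.range fun p : stdSimplex ℝ (Fin m) =>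
      expectedPayoff A p q) := fun q =>
    (isCompact_range (hc.comp (continuous_subtype_val.prodMk continuous_const))).bddAbove
  have hle : ∀ p : stdSimplex ℝ (Fin m), ⨅ q : stdSimplex ℝ (Fin n), expectedPayoff A p q ≤
      expectedPayoff A p₀ q₀ := fun p =>
    (ciInf_le (hb1 p) ⟨q₀, hq₀⟩).trans (hs' ⟨q₀, hq₀⟩ p)
  have hge : ∀ q : stdSimplex ℝ (Fin n), expectedPayoff A p₀ q₀ ≤
      ⨆ p : stdSimplex ℝ (Fin m), expectedPayoff A p q := fun q =>
    (hs' q ⟨p₀, hp₀⟩).trans (le_ciSup (hb2 q) ⟨p₀, hp₀⟩)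
  have hv : expectedPayoff A p₀ q₀ = gameValue A := by
    refine le_antisymm ?_ (ciSup_le hle)
    exact (le_ciInf fun q => hs' q ⟨p₀, hp₀⟩).trans
      (le_ciSup (f := fun p : stdSimplex ℝ (Fin m) =>
        ⨅ q : stdSimplex ℝ (Fin n), expectedPayoff A p q)
        ⟨_, Set.forall_mem_range.2 hle⟩ ⟨p₀, hp₀⟩)
  refine ⟨⟨p₀, hp₀⟩, ⟨q₀, hq₀⟩, fun q => hv ▸ hs' q ⟨p₀, hp₀⟩,
    fun p => hv ▸ hs' ⟨q₀, hq₀⟩ p, hv, ?_⟩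
  rw [← hv]
  refine le_antisymm (le_ciInf hge) ?_
  exact (ciInf_le (f := fun q : stdSimplex ℝ (Fin n) =>
    ⨆ p : stdSimplex ℝ (Fin m), expectedPayoff A p q)
    ⟨_, Set.forall_mem_range.2 hge⟩ ⟨q₀, hq₀⟩).trans (ciSup_le fun p => hs' ⟨q₀, hq₀⟩ p)

/-- `X` is a random variable (or random vector) whose distribution has a density function `f` that
is symmetric with respect to the origin: `f (-x) = f x`. -/
def HasEvenDensity {Ω E : Type*} [MeasurableSpace Ω] [MeasureSpace E] [Neg E]
    (X : Ω → E) (P : Measure Ω) : Prop :=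
  Measurable X ∧ ∃ f : E → ENNReal, Measurable f ∧ (∀ x, f (-x) = f x) ∧
    P.map X = (volume : Measure E).withDensity f

/-!
The value of the game `A` is positive exactly if some `p` with positive entries satisfies `pᵗ A > 0`
(`gameValue_pos_iff`), that is, if the `m` coordinate functionals and the `n` columns of `A`, all
regarded as linear functionals on `ℝᵐ`, are positive at a common point. Likewise the origin lies
outside the convex hull of points `z k` exactly if the functionals `⟪z k, ·⟫` are positive at a
common point (`notMem_convexHull_range_iff`). So both probabilities are the probability that the
all-ones sign vector is realized by a random family of `m + n` linear functionals on `ℝᵐ`.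

Both random families have the same two features. First, replacing the functionals by arbitrary
sign changes of them amounts to changing the signs of the independent random variables, which
preserves their joint law (`measurePreserving_units_smul`): for the game, the signs attached to
row `i` and column `j` multiply the entry `a i j` by their product. Hence all `2 ^ (m + n)` sign
vectors are realized with equal probability. Second, the families are almost surely in general
position, because the joint law has a density and the relevant determinants do not vanish
identically (`ae_det_ne_zero`). The number of sign vectors realized by a family in general position
is the number of regions of the corresponding central hyperplane arrangement, which depends on `m`
and `m + n` only: deletion–restriction (`ncard_signPatterns_succ`) turns it into a recursion of
Pascal type, solved in `ncard_signPatterns`. Dividing by `2 ^ (m + n)` gives the common value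
(`measureReal_one_mem_signPatterns`).
-/

open Module

/-! ### Regions of central hyperplane arrangements -/

section Arrangement

variable {ι κ E : Type*} [AddCommGroup E] [Module ℝ E]

/-- The sign vectors realized by a family `f` of linear functionals: they correspond to the open
regions into which the hyperplanes `ker (f k)` cut the space. -/
def signPatterns (f : ι → Dual ℝ E) : Set (ι → ℤˣ) :=
  {s | ∃ p : E, ∀ k, 0 < s k • f k p}

/-- A family of linear functionals is in general position if any `finrank ℝ E` of them (with
distinct indices) have only the zero vector as a common zero. If the family has fewer than
`finrank ℝ E` members, this says nothing. -/
def InGeneralPosition (f : ι → Dual ℝ E) : Prop :=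
  ∀ S : Finset ι, S.card = finrank ℝ E → ∀ x, (∀ k ∈ S, f k x = 0) → x = 0

theorem units_smul_pos_iff (u : ℤˣ) (x : ℝ) :
    0 < u • x ↔ (u = 1 ∧ 0 < x) ∨ (u = -1 ∧ x < 0) := by
  rcases Int.units_eq_one_or u with rfl | rfl
  · simp [show (1 : ℤˣ) ≠ -1 by decide]
  · simp [show (-1 : ℤˣ) ≠ 1 by decide]

theorem ncard_signPatterns_comp_equiv (e : κ ≃ ι) (f : ι → Dual ℝ E) :
    (signPatterns (f ∘ e)).ncard = (signPatterns f).ncard := by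
  have h : signPatterns f = (fun s : κ → ℤˣ => s ∘ e.symm) '' signPatterns (f ∘ e) := by
    ext s
    constructor
    · rintro ⟨p, hp⟩
      exact ⟨s ∘ e, ⟨p, fun k => hp (e k)⟩, by ext k; simp⟩
    · rintro ⟨t, ⟨p, hp⟩, rfl⟩
      exact ⟨p, fun k => by simpa using hp (e.symm k)⟩
  rw [h, Set.ncard_image_of_injective _ e.symm.surjective.injective_comp_right]

theorem InGeneralPosition.comp_embedding {f : ι → Dual ℝ E} (hf : InGeneralPosition f)
    (e : κ ↪ ι) : InGeneralPosition (f ∘ e) := fun S hS x hx =>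
  hf (S.map e) (by simpa using hS) x (by simpa using hx)

/-- In general position, any `finrank ℝ E` of the functionals are coordinates on `E`. -/
theorem InGeneralPosition.exists_forall_eq [FiniteDimensional ℝ E] {f : ι → Dual ℝ E}
    (hf : InGeneralPosition f) {S : Finset ι} (hS : S.card = finrank ℝ E) (c : ι → ℝ) :
    ∃ x, ∀ k ∈ S, f k x = c k := by
  let g : E →ₗ[ℝ] (S → ℝ) := LinearMap.pi fun k => f k
  have hg : Function.Injective g := by
    rw [← LinearMap.ker_eq_bot, LinearMap.ker_eq_bot']
    exact fun x hx => hf S hS x fun k hk => congrFun hx ⟨k, hk⟩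
  obtain ⟨x, hx⟩ := (LinearMap.injective_iff_surjective_of_finrank_eq_finrank
    (by simp [hS])).1 hg fun k => c k
  exact ⟨x, fun k hk => congrFun hx ⟨k, hk⟩⟩

theorem InGeneralPosition.exists_eq_one [Fintype ι] [FiniteDimensional ℝ E] {f : ι → Dual ℝ E}
    (hf : InGeneralPosition f) (h0 : 0 < finrank ℝ E) (h : finrank ℝ E ≤ Fintype.card ι) (k : ι) :
    ∃ x, f k x = 1 := by
  obtain ⟨S, hkS, -, hS⟩ := Finset.exists_subsuperset_card_eq (s := {k})
    (n := finrank ℝ E) (Finset.subset_univ _) (by rw [Finset.card_singleton]; exact h0) h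
  obtain ⟨x, hx⟩ := hf.exists_forall_eq hS fun _ => 1
  exact ⟨x, hx k (by simpa using hkS)⟩

theorem signPatterns_eq_univ [Fintype ι] [FiniteDimensional ℝ E] {f : ι → Dual ℝ E}
    (hf : InGeneralPosition f) (h : Fintype.card ι = finrank ℝ E) :
    signPatterns f = Set.univ := by
  refine Set.eq_univ_of_forall fun s => ?_
  obtain ⟨x, hx⟩ := hf.exists_forall_eq (S := Finset.univ) (by simpa using h)
    fun k => ((s k : ℤ) : ℝ)
  refine ⟨x, fun k => ?_⟩
  rw [hx k (Finset.mem_univ k)]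
  rcases Int.units_eq_one_or (s k) with h | h <;> simp [h]

theorem signPatterns_eq_empty [Nonempty ι] [Subsingleton E] (f : ι → Dual ℝ E) :
    signPatterns f = ∅ := by
  refine Set.eq_empty_of_forall_notMem fun s ⟨p, hp⟩ => ?_
  obtain ⟨k⟩ := ‹Nonempty ι›
  simpa [Subsingleton.elim p 0] using hp k

/-- Finitely many strict inequalities survive a small move in a direction `v`. -/
theorem exists_pos_forall_pos_add [Finite ι] (f : ι → Dual ℝ E) (s : ι → ℤˣ) {p : E}
    (hp : ∀ k, 0 < s k • f k p) (v : E) : ∃ t : ℝ, 0 < t ∧ ∀ k, 0 < s k • f k (p + t • v) := by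
  have h : ∀ᶠ t in nhdsWithin (0 : ℝ) (Set.Ioi 0), ∀ k, 0 < s k • f k (p + t • v) := by
    refine nhdsWithin_le_nhds (Filter.eventually_all.2 fun k => ?_)
    have hc : Continuous fun t : ℝ => s k • f k (p + t • v) := by
      simp only [map_add, map_smul, Units.smul_def, zsmul_eq_mul, smul_eq_mul]
      fun_prop
    exact hc.continuousAt.eventually (lt_mem_nhds (by simpa using hp k))
  obtain ⟨t, ht, ht'⟩ := (h.and self_mem_nhdsWithin).exists
  exact ⟨t, ht', ht⟩

section DeletionRestriction

variable {N : ℕ} (f : Fin (N + 1) → Dual ℝ E)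

/-- A sign vector of all functionals but the first extends to one of the whole family, since a
point on `ker (f 0)` can be moved off it. -/
theorem cons_mem_signPatterns_or_iff {v : E} (hv : f 0 v = 1) (s : Fin N → ℤˣ) :
    (Fin.cons 1 s : Fin (N + 1) → ℤˣ) ∈ signPatterns f ∨
      (Fin.cons (-1) s : Fin (N + 1) → ℤˣ) ∈ signPatterns f ↔
    s ∈ signPatterns fun k => f k.succ := by
  simp only [signPatterns, Set.mem_ofPred_eq, Fin.forall_fin_succ, Fin.cons_zero, Fin.cons_succ]
  constructor
  · rintro (⟨p, -, hp⟩ | ⟨p, -, hp⟩) <;> exact ⟨p, hp⟩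
  · rintro ⟨p, hp⟩
    rcases lt_trichotomy (f 0 p) 0 with h | h | h
    · exact Or.inr ⟨p, by simpa using h, hp⟩
    · obtain ⟨t, ht, h'⟩ := exists_pos_forall_pos_add (fun k => f k.succ) s hp v
      exact Or.inl ⟨p + t • v, by simpa [h, hv] using ht, h'⟩
    · exact Or.inl ⟨p, by simpa using h, hp⟩

/-- A sign vector of all functionals but the first extends in both ways exactly if its region
meets `ker (f 0)`: the segment between points on the two sides crosses the hyperplane. -/
theorem cons_mem_signPatterns_and_iff {v : E} (hv : f 0 v = 1) (s : Fin N → ℤˣ) :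
    (Fin.cons 1 s : Fin (N + 1) → ℤˣ) ∈ signPatterns f ∧
      (Fin.cons (-1) s : Fin (N + 1) → ℤˣ) ∈ signPatterns f ↔
    s ∈ signPatterns fun k => (f k.succ).domRestrict (LinearMap.ker (f 0)) := by
  simp only [signPatterns, Set.mem_ofPred_eq, Fin.forall_fin_succ, Fin.cons_zero, Fin.cons_succ,
    LinearMap.domRestrict_apply]
  constructor
  · rintro ⟨⟨p, hp0, hp⟩, q, hq0, hq⟩
    rw [one_smul] at hp0
    rw [Units.neg_smul, one_smul, Left.neg_pos_iff] at hq0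
    refine ⟨⟨f 0 p • q + (-f 0 q) • p, ?_⟩, fun k => ?_⟩
    · simp only [LinearMap.mem_ker, map_add, map_smul, smul_eq_mul]
      ring
    · have h1 := mul_pos hp0 (hq k)
      have h2 := mul_pos (neg_pos.2 hq0) (hp k)
      rw [map_add, map_smul, map_smul, smul_add, smul_comm, smul_comm (s k) (-f 0 q)]
      exact add_pos h1 h2
  · rintro ⟨⟨p, hp0⟩, hp⟩
    rw [LinearMap.mem_ker] at hp0
    obtain ⟨t, ht, h⟩ := exists_pos_forall_pos_add (fun k => f k.succ) s hp v
    obtain ⟨t', ht', h'⟩ := exists_pos_forall_pos_add (fun k => f k.succ) s hp (-v)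
    exact ⟨⟨p + t • v, by simpa [hp0, hv] using ht, h⟩,
      ⟨p + t' • -v, by simpa [hp0, hv] using ht', h'⟩⟩

theorem ncard_eq_ncard_cons_add_ncard_cons (R : Set (Fin (N + 1) → ℤˣ)) :
    R.ncard = {s : Fin N → ℤˣ | (Fin.cons 1 s : Fin (N + 1) → ℤˣ) ∈ R}.ncard +
      {s : Fin N → ℤˣ | (Fin.cons (-1) s : Fin (N + 1) → ℤˣ) ∈ R}.ncard := by
  have hinj : ∀ u : ℤˣ,
      Function.Injective fun s : Fin N → ℤˣ => (Fin.cons u s : Fin (N + 1) → ℤˣ) :=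
    fun u => Fin.cons_right_injective (α := fun _ => ℤˣ) u
  rw [← Set.ncard_image_of_injective _ (hinj 1), ← Set.ncard_image_of_injective _ (hinj (-1)),
    ← Set.ncard_union_eq]
  · congr 1
    ext s
    constructor
    · intro hs
      rw [← Fin.cons_self_tail s] at hs ⊢
      rcases Int.units_eq_one_or (s 0) with h | h <;> rw [h] at hs ⊢
      · exact Or.inl ⟨_, hs, rfl⟩
      · exact Or.inr ⟨_, hs, rfl⟩
    · rintro (⟨t, ht, rfl⟩ | ⟨t, ht, rfl⟩) <;> exact ht
  · refine Set.disjoint_left.2 ?_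
    rintro _ ⟨t, -, rfl⟩ ⟨t', -, h⟩
    have := congrFun h 0
    simp only [Fin.cons_zero] at this
    exact absurd this (by decide)

/-- Deletion–restriction: the hyperplane `ker (f 0)` cuts in two just those regions of the other
hyperplanes which it meets. -/
theorem ncard_signPatterns_succ {v : E} (hv : f 0 v = 1) :
    (signPatterns f).ncard = (signPatterns fun k : Fin N => f k.succ).ncard +
      (signPatterns fun k : Fin N => (f k.succ).domRestrict (LinearMap.ker (f 0))).ncard := by
  rw [ncard_eq_ncard_cons_add_ncard_cons, ← Set.ncard_union_add_ncard_inter]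
  congr 2
  · ext s
    exact cons_mem_signPatterns_or_iff f hv s
  · ext s
    exact cons_mem_signPatterns_and_iff f hv s

theorem InGeneralPosition.domRestrict_ker {f : Fin (N + 1) → Dual ℝ E}
    (hf : InGeneralPosition f) (hker : finrank ℝ (LinearMap.ker (f 0)) + 1 = finrank ℝ E) :
    InGeneralPosition fun k : Fin N => (f k.succ).domRestrict (LinearMap.ker (f 0)) := by
  intro S hS x hx
  refine Subtype.ext (hf (Finset.cons 0 (S.map (Fin.succEmb N)) (by simp)) ?_ x ?_)
  · simp [hS, hker]
  · intro k hk
    rcases Finset.mem_cons.1 hk with rfl | hk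
    · exact x.2
    · obtain ⟨j, hj, rfl⟩ := Finset.mem_map.1 hk
      exact hx j hj

end DeletionRestriction

theorem sum_range_choose_add_sum_range_choose (N d : ℕ) :
    ∑ j ∈ Finset.range (d + 1), N.choose j + ∑ j ∈ Finset.range d, N.choose j =
      ∑ j ∈ Finset.range (d + 1), (N + 1).choose j := by
  rw [Finset.sum_range_succ' _ d, Finset.sum_range_succ' _ d]
  simp only [Nat.choose_succ_succ, Finset.sum_add_distrib, Nat.choose_zero_right]
  ring

/-- The number of regions of a central arrangement of `N + 1 ≥ dim E` hyperplanes in general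
position. -/
theorem ncard_signPatterns_fin (N : ℕ) : ∀ {E : Type*} [AddCommGroup E] [Module ℝ E]
    [FiniteDimensional ℝ E] {f : Fin (N + 1) → Dual ℝ E}, InGeneralPosition f →
      finrank ℝ E ≤ N + 1 →
      (signPatterns f).ncard = 2 * ∑ j ∈ Finset.range (finrank ℝ E), N.choose j := by
  induction N with
  | zero =>
    intro E _ _ _ f hf h
    rcases Nat.le_one_iff_eq_zero_or_eq_one.1 h with h | h
    · have := finrank_zero_iff.1 h
      rw [signPatterns_eq_empty, h]
      simp
    · rw [signPatterns_eq_univ hf (by simp [h]), h, Set.ncard_univ]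
      simp
  | succ N ih =>
    intro E _ _ _ f hf h
    rcases Nat.eq_zero_or_pos (finrank ℝ E) with h0 | h0
    · have := finrank_zero_iff.1 h0
      rw [signPatterns_eq_empty, h0]
      simp
    -- Here deletion would leave fewer functionals than dimensions, a vacuous general position.
    rcases h.eq_or_lt with h1 | h1
    · rw [signPatterns_eq_univ hf (by simp [h1]), h1, Set.ncard_univ, Nat.sum_range_choose]
      simp [pow_succ']
    · obtain ⟨v, hv⟩ := hf.exists_eq_one h0 (by simpa using h) 0
      have hf0 : f 0 ≠ 0 := fun h => by simp [h] at hv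
      have hker := Dual.finrank_ker_add_one_of_ne_zero hf0
      rw [ncard_signPatterns_succ f hv, ih (f := fun k => f k.succ)
        (hf.comp_embedding (Fin.succEmb _)) (by omega),
        ih (hf.domRestrict_ker hker) (by omega), ← hker, ← mul_add,
        sum_range_choose_add_sum_range_choose]

theorem ncard_signPatterns [Fintype ι] [Nonempty ι] [FiniteDimensional ℝ E]
    {f : ι → Dual ℝ E} (hf : InGeneralPosition f) (h : finrank ℝ E ≤ Fintype.card ι) :
    (signPatterns f).ncard =
      2 * ∑ j ∈ Finset.range (finrank ℝ E), (Fintype.card ι - 1).choose j := by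
  obtain ⟨N, hN⟩ := Nat.exists_eq_add_one.2 (Fintype.card_pos (α := ι))
  let e : Fin (N + 1) ≃ ι := (Fintype.equivFinOfCardEq hN).symm
  rw [← ncard_signPatterns_comp_equiv e,
    ncard_signPatterns_fin N (f := f ∘ e) (hf.comp_embedding e.toEmbedding) (hN ▸ h), hN,
    Nat.add_sub_cancel]

end Arrangement

/-! ### Almost sure nonvanishing of determinants -/

section GeneralPosition

theorem absolutelyContinuous_pi_fin {n : ℕ} {X : Fin n → Type*} [∀ i, MeasurableSpace (X i)]
    {μ ν : ∀ i, Measure (X i)} [∀ i, SigmaFinite (μ i)] [∀ i, SigmaFinite (ν i)]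
    (h : ∀ i, μ i ≪ ν i) : Measure.pi μ ≪ Measure.pi ν := by
  induction n with
  | zero => rw [Measure.pi_of_empty μ, Measure.pi_of_empty ν]
  | succ n ih =>
    rw [← (measurePreserving_piFinSuccAbove μ 0).symm.map_eq,
      ← (measurePreserving_piFinSuccAbove ν 0).symm.map_eq]
    exact ((h 0).prod (ih fun i => h _)).map (MeasurableEquiv.measurable _)

theorem absolutelyContinuous_pi {ι : Type*} [Fintype ι] {X : ι → Type*}
    [∀ i, MeasurableSpace (X i)] {μ ν : ∀ i, Measure (X i)} [∀ i, SigmaFinite (μ i)]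
    [∀ i, SigmaFinite (ν i)] (h : ∀ i, μ i ≪ ν i) : Measure.pi μ ≪ Measure.pi ν := by
  let e := (Fintype.equivFin ι).symm
  rw [← (measurePreserving_piCongrLeft μ e).map_eq, ← (measurePreserving_piCongrLeft ν e).map_eq]
  exact (absolutelyContinuous_pi_fin fun i => h (e i)).map (MeasurableEquiv.measurable _)

/-- If the determinant of a matrix depending linearly on `x` is not identically zero, then it is
almost everywhere nonzero: on each line in the direction of a point `v` where it does not vanish
it is a polynomial with leading coefficient `det (L v)`. -/
theorem ae_det_ne_zero {V κ : Type*} [NormedAddCommGroup V] [NormedSpace ℝ V]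
    [FiniteDimensional ℝ V] [MeasurableSpace V] [BorelSpace V] [Fintype κ] [DecidableEq κ]
    (μ : Measure V) [μ.IsAddHaarMeasure] (L : V →ₗ[ℝ] Matrix κ κ ℝ) {v : V}
    (hv : (L v).det ≠ 0) : ∀ᵐ x ∂μ, (L x).det ≠ 0 := by
  have hc : Continuous fun x => (L x).det := by
    have : Continuous L := L.continuous_of_finiteDimensional
    fun_prop
  refine ae_mem_of_ae_add_linearMap_mem (LinearMap.toSpanSingleton ℝ V v) volume μ
    (s := {x | (L x).det ≠ 0}) (isOpen_ne_fun hc continuous_const).measurableSet fun y => ?_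
  let q : Polynomial ℝ := Matrix.det
    ((Polynomial.X : Polynomial ℝ) • (L v).map Polynomial.C + (L y).map Polynomial.C)
  have hq : q ≠ 0 := fun h => hv <| by
    rw [← Polynomial.coeff_det_X_add_C_card (L v) (L y)]
    exact congrArg (fun r => Polynomial.coeff r _) h
  have heval : ∀ t : ℝ, q.eval t = (L (y + LinearMap.toSpanSingleton ℝ V v t)).det := fun t => by
    rw [← Polynomial.coe_evalRingHom, RingHom.map_det]
    congr 1
    ext i j
    simp [add_comm, mul_comm t]
  have hfin : {t : ℝ | q.IsRoot t}.Finite := Polynomial.finite_setOfPred_isRoot hq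
  filter_upwards [hfin.countable.ae_notMem volume] with t ht h
  exact ht ((heval t).trans h)

end GeneralPosition

/-! ### Symmetric laws -/

section SignSymmetry

variable {ι X E : Type*}

theorem isOpen_mem_signPatterns [Finite ι] [AddCommGroup E] [Module ℝ E] [TopologicalSpace X]
    {F : X → ι → Dual ℝ E} (hF : ∀ k p, Continuous fun x => F x k p) (s : ι → ℤˣ) :
    IsOpen {x | s ∈ signPatterns (F x)} := by
  have : {x | s ∈ signPatterns (F x)} = ⋃ p, ⋂ k, {x | 0 < s k • F x k p} := by
    ext x
    simp [signPatterns]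
  rw [this]
  refine isOpen_iUnion fun p => isOpen_iInter_of_finite fun k => isOpen_lt continuous_const ?_
  simp only [Units.smul_def, zsmul_eq_mul]
  exact continuous_const.mul (hF k p)

/-- Averaging over all changes of sign: if the law of a random family of functionals in general
position is invariant under them, then each of the `2 ^ card ι` sign vectors is realized with
the same probability, while the number of realized sign vectors is almost surely constant. The map
`T s` on the space of random data realizes the change of signs `s`. -/
theorem measureReal_one_mem_signPatterns [Fintype ι] [Nonempty ι] [AddCommGroup E] [Module ℝ E]
    [FiniteDimensional ℝ E] (hcard : finrank ℝ E ≤ Fintype.card ι)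
    [TopologicalSpace X] [MeasurableSpace X] [OpensMeasurableSpace X]
    (μ : Measure X) [IsProbabilityMeasure μ] (F : X → ι → Dual ℝ E)
    (hF : ∀ k p, Continuous fun x => F x k p)
    (hgen : ∀ᵐ x ∂μ, InGeneralPosition (F x))
    (T : (ι → ℤˣ) → X → X) (hT : ∀ s, MeasurePreserving (T s) μ μ)
    (hTF : ∀ s x, 1 ∈ signPatterns (F (T s x)) ↔ s ∈ signPatterns (F x)) :
    μ.real {x | 1 ∈ signPatterns (F x)} = (1 / 2 ^ (Fintype.card ι - 1) : ℝ) *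
      ∑ j ∈ Finset.range (finrank ℝ E), ((Fintype.card ι - 1).choose j : ℝ) := by
  classical
  have hmeas : ∀ s, MeasurableSet {x | s ∈ signPatterns (F x)} :=
    fun s => (isOpen_mem_signPatterns hF s).measurableSet
  have heq : ∀ s, μ.real {x | s ∈ signPatterns (F x)} = μ.real {x | 1 ∈ signPatterns (F x)} :=
    fun s => by
      rw [← (hT s).measureReal_preimage (hmeas 1).nullMeasurableSet]
      congr 1
      ext x
      exact (hTF s x).symm
  have hsum : ∑ s : ι → ℤˣ, μ.real {x | s ∈ signPatterns (F x)} =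
      2 * ∑ j ∈ Finset.range (finrank ℝ E), ((Fintype.card ι - 1).choose j : ℝ) := by
    simp_rw [← integral_indicator_one (hmeas _)]
    simp only [Pi.one_def]
    rw [← integral_finsetSum _ fun s _ => (integrable_const (1 : ℝ)).indicator (hmeas s)]
    trans ∫ _, (2 * ∑ j ∈ Finset.range (finrank ℝ E), ((Fintype.card ι - 1).choose j : ℝ)) ∂μ
    · refine integral_congr_ae (hgen.mono fun x hx => ?_)
      have := congrArg (Nat.cast (R := ℝ)) (ncard_signPatterns hx hcard)
      push_cast at this
      rw [← this]
      simp [Set.indicator_apply, Finset.sum_boole, Set.ncard_eq_toFinset_card']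
    · simp
  simp only [heq, Finset.sum_const, Finset.card_univ, Fintype.card_pi, Fintype.card_units_int,
    Finset.prod_const, nsmul_eq_mul] at hsum
  obtain ⟨N, hN⟩ := Nat.exists_eq_add_one.2 (Fintype.card_pos (α := ι))
  rw [hN, Nat.add_sub_cancel] at hsum ⊢
  push_cast at hsum
  rw [pow_succ'] at hsum
  field_simp
  linarith

theorem HasEvenDensity.map_neg {Ω : Type*} [MeasurableSpace Ω] {P : Measure Ω}
    [AddGroup X] [MeasureSpace X] [MeasurableNeg X]
    [(volume : Measure X).IsNegInvariant] {Z : Ω → X} (hZ : HasEvenDensity Z P) :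
    P.map (fun ω => -Z ω) = P.map Z := by
  obtain ⟨hm, f, hf, hsymm, hmap⟩ := hZ
  have h : P.map (fun ω => -Z ω) = (P.map Z).map Neg.neg :=
    (Measure.map_map measurable_neg hm).symm
  rw [h, hmap]
  ext s hs
  rw [Measure.map_apply measurable_neg hs, withDensity_apply _ hs,
    withDensity_apply _ (measurable_neg hs)]
  have := (Measure.measurePreserving_neg (volume : Measure X)).setLIntegral_comp_preimage hs hf
  simpa only [hsymm] using this

variable {Ω : Type*} [MeasurableSpace Ω] {P : Measure Ω} [Fintype ι] [AddCommGroup X]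
  [MeasureSpace X] {Z : ι → Ω → X}

theorem measurable_units_smul [MeasurableNeg X] (u : ℤˣ) : Measurable fun x : X => u • x := by
  rcases Int.units_eq_one_or u with rfl | rfl
  · simpa using measurable_id'
  · simpa using measurable_neg

/-- The joint law of independent variables with symmetric densities is invariant under changes of
the signs of the variables. -/
theorem measurePreserving_units_smul [MeasurableNeg X] [(volume : Measure X).IsNegInvariant]
    (hindep : iIndepFun Z P) (hZ : ∀ k, HasEvenDensity (Z k) P) (s : ι → ℤˣ) :
    MeasurePreserving (fun (x : ι → X) k => s k • x k) (P.map fun ω k => Z k ω)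
      (P.map fun ω k => Z k ω) := by
  have hT : Measurable fun (x : ι → X) k => s k • x k :=
    measurable_pi_lambda _ fun k => (measurable_units_smul (s k)).comp (measurable_pi_apply k)
  refine ⟨hT, ?_⟩
  rw [Measure.map_map hT (measurable_pi_lambda _ fun k => (hZ k).1)]
  refine ((hindep.comp _ fun k => measurable_units_smul (s k)).map_fun_eq_pi_map fun k =>
    ((measurable_units_smul (s k)).comp (hZ k).1).aemeasurable).trans ?_
  rw [hindep.map_fun_eq_pi_map fun k => (hZ k).1.aemeasurable]
  congr 1
  ext1 k
  rcases Int.units_eq_one_or (s k) with h | h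
  · simp [h, Function.comp_def]
  · simpa [h, Function.comp_def] using (hZ k).map_neg

theorem absolutelyContinuous_map [IsProbabilityMeasure P] [SigmaFinite (volume : Measure X)]
    (hindep : iIndepFun Z P) (hZ : ∀ k, HasEvenDensity (Z k) P) :
    (P.map fun ω k => Z k ω) ≪ (volume : Measure (ι → X)) := by
  rw [hindep.map_fun_eq_pi_map fun k => (hZ k).1.aemeasurable]
  have : ∀ k, IsProbabilityMeasure (P.map (Z k)) := fun k =>
    Measure.isProbabilityMeasure_map (hZ k).1.aemeasurable
  refine absolutelyContinuous_pi fun k => ?_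
  obtain ⟨-, f, -, -, hmap⟩ := hZ k
  rw [hmap]
  exact withDensity_absolutelyContinuous _ _

end SignSymmetry

/-! ### Convex hulls of random points -/

section Wendel

variable {ι : Type*}

theorem notMem_convexHull_range_iff [Finite ι] {m : ℕ} (z : ι → EuclideanSpace ℝ (Fin m)) :
    (0 : EuclideanSpace ℝ (Fin m)) ∉ convexHull ℝ (Set.range z) ↔
      1 ∈ signPatterns fun k => (innerₛₗ ℝ (z k) : Dual ℝ (EuclideanSpace ℝ (Fin m))) := by
  simp only [signPatterns, Set.mem_ofPred_eq, Pi.one_apply, one_smul, innerₛₗ_apply_apply]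
  constructor
  · intro h
    obtain ⟨f, u, hu, hf⟩ := geometric_hahn_banach_point_closed (convex_convexHull ℝ _)
      ((Set.finite_range z).isClosed_convexHull ℝ) h
    refine ⟨(InnerProductSpace.toDual ℝ (EuclideanSpace ℝ (Fin m))).symm f, fun k => ?_⟩
    rw [real_inner_comm, InnerProductSpace.toDual_symm_apply]
    rw [map_zero] at hu
    exact hu.trans (hf _ (subset_convexHull ℝ _ ⟨k, rfl⟩))
  · rintro ⟨p, hp⟩ h
    have hc : Convex ℝ {x : EuclideanSpace ℝ (Fin m) | 0 < inner ℝ p x} :=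
      convex_halfSpace_gt (innerₗ _ p).isLinear 0
    have := convexHull_min (Set.range_subset_iff.2 fun k => by
      simpa [real_inner_comm] using hp k) hc h
    simp at this

/-- Points of `ℝᵐ` are almost surely in general position: a determinant of `m` of them does not
vanish identically, as it is `1` at the standard basis. -/
theorem ae_inGeneralPosition_inner [Fintype ι] {m : ℕ} :
    ∀ᵐ z : ι → EuclideanSpace ℝ (Fin m), InGeneralPosition fun k =>
      (innerₛₗ ℝ (z k) : Dual ℝ (EuclideanSpace ℝ (Fin m))) := by
  refine (ae_all_iff.2 fun S => ?_ : ∀ᵐ z : ι → EuclideanSpace ℝ (Fin m), ∀ S : Finset ι,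
    S.card = _ → ∀ x, (∀ k ∈ S, innerₛₗ ℝ (z k) x = 0) → x = 0)
  by_cases hS : S.card = finrank ℝ (EuclideanSpace ℝ (Fin m))
  swap
  · exact Filter.Eventually.of_forall fun z h => absurd h hS
  classical
  let e : S ≃ Fin m := S.equivFinOfCardEq (by simpa using hS)
  let L : (ι → EuclideanSpace ℝ (Fin m)) →ₗ[ℝ] Matrix (Fin m) (Fin m) ℝ :=
    { toFun := fun z => Matrix.of fun i j => z (e.symm i) j
      map_add' := fun _ _ => rfl
      map_smul' := fun _ _ => rfl }
  let v : ι → EuclideanSpace ℝ (Fin m) := fun k =>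
    if h : k ∈ S then EuclideanSpace.single (e ⟨k, h⟩) 1 else 0
  have hbasis : ∀ i, v (e.symm i) = EuclideanSpace.single i 1 := fun i => by simp [v]
  have hv : L v = 1 := by
    ext i j
    change v (e.symm i) j = _
    rw [hbasis, Matrix.one_apply, PiLp.single_apply]
    exact if_congr eq_comm rfl rfl
  filter_upwards [ae_det_ne_zero volume L (v := v) (by simp [hv])] with z hz _ x hx
  have : (x : Fin m → ℝ) = 0 := by
    refine Matrix.eq_zero_of_mulVec_eq_zero hz ?_
    ext i
    have := hx (e.symm i) (e.symm i).2
    rw [innerₛₗ_apply_apply, PiLp.inner_apply] at this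
    exact (Finset.sum_congr rfl fun j _ => mul_comm _ _).trans this
  ext i
  exact congrFun this i

/-- Wendel's theorem for independent, not necessarily identically distributed points. -/
theorem measureReal_zero_notMem_convexHull {Ω : Type*} [MeasurableSpace Ω] (P : Measure Ω)
    [IsProbabilityMeasure P] [Fintype ι] [Nonempty ι] {m : ℕ} (hm : m ≤ Fintype.card ι)
    (z : ι → Ω → EuclideanSpace ℝ (Fin m)) (hindep : iIndepFun z P)
    (heven : ∀ k, HasEvenDensity (z k) P) :
    P.real {ω | (0 : EuclideanSpace ℝ (Fin m)) ∉ convexHull ℝ (Set.range fun k => z k ω)} =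
      (1 / 2 ^ (Fintype.card ι - 1) : ℝ) *
        ∑ j ∈ Finset.range m, ((Fintype.card ι - 1).choose j : ℝ) := by
  have hZ : Measurable fun ω k => z k ω := measurable_pi_lambda _ fun k => (heven k).1
  have := Measure.isProbabilityMeasure_map (μ := P) hZ.aemeasurable
  have hF : ∀ k p, Continuous fun z : ι → EuclideanSpace ℝ (Fin m) =>
      (innerₛₗ ℝ (z k) : Dual ℝ (EuclideanSpace ℝ (Fin m))) p := fun k p => by
    simp only [innerₛₗ_apply_apply]
    fun_prop
  have key := measureReal_one_mem_signPatterns (by simpa using hm) (P.map fun ω k => z k ω) _ hF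
    ((absolutelyContinuous_map hindep heven).ae_le ae_inGeneralPosition_inner)
    (fun s z k => s k • z k) (measurePreserving_units_smul hindep heven)
    (fun s z => by simp [signPatterns, Units.smul_def])
  rw [finrank_euclideanSpace_fin] at key
  rw [← key, map_measureReal_apply hZ (isOpen_mem_signPatterns hF 1).measurableSet]
  simp only [notMem_convexHull_range_iff]
  rfl

end Wendel

/-! ### Random games -/

section Game

variable {m n : ℕ}

/-- The game favors the row player exactly if some completely mixed strategy, here not normalized,
gains against each pure strategy of the column player. -/
theorem gameValue_pos_iff (hm : 0 < m) (hn : 0 < n) (A : Matrix (Fin m) (Fin n) ℝ) :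
    0 < gameValue A ↔ ∃ p : Fin m → ℝ, (∀ i, 0 < p i) ∧ ∀ j, 0 < ∑ i, p i * A i j := by
  obtain ⟨p₀, q₀, hp₀, hq₀, -, -⟩ := gameValue_minimax hm hn A
  constructor
  · intro h
    have hpos : ∀ j, 0 < ∑ i, (p₀ : Fin m → ℝ) i * A i j := fun j => by
      have := h.trans_le (hp₀ ⟨Pi.single j 1, single_mem_stdSimplex ℝ j⟩)
      simpa [expectedPayoff, Pi.single_apply] using this
    -- Some weights of the optimal strategy may vanish, so it is moved into the open orthant.
    have hev : ∀ᶠ t in nhdsWithin (0 : ℝ) (Set.Ioi 0),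
        ∀ j, 0 < ∑ i, ((p₀ : Fin m → ℝ) i + t) * A i j := by
      refine nhdsWithin_le_nhds (Filter.eventually_all.2 fun j => ?_)
      have hc : Continuous fun t : ℝ => ∑ i, ((p₀ : Fin m → ℝ) i + t) * A i j := by fun_prop
      exact hc.continuousAt.eventually (lt_mem_nhds (by simpa using hpos j))
    obtain ⟨t, ht, ht'⟩ := (hev.and self_mem_nhdsWithin).exists
    exact ⟨fun i => (p₀ : Fin m → ℝ) i + t, fun i => add_pos_of_nonneg_of_pos (p₀.2.1 i) ht', ht⟩
  · rintro ⟨p, hp, hpA⟩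
    have hs : 0 < ∑ i, p i := Finset.sum_pos (fun i _ => hp i) ⟨⟨0, hm⟩, Finset.mem_univ _⟩
    let p' : stdSimplex ℝ (Fin m) := ⟨fun i => p i / ∑ i, p i,
      fun i => (div_pos (hp i) hs).le, by rw [← Finset.sum_div, div_self hs.ne']⟩
    refine lt_of_lt_of_le ?_ (hq₀ p')
    have heq : expectedPayoff A p' q₀ =
        ∑ j, (q₀ : Fin n → ℝ) j * ((∑ i, p i * A i j) / ∑ i, p i) := by
      rw [expectedPayoff, Finset.sum_comm]
      refine Finset.sum_congr rfl fun j _ => ?_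
      rw [Finset.sum_div, Finset.mul_sum]
      exact Finset.sum_congr rfl fun i _ => by
        change p i / (∑ i, p i) * A i j * (q₀ : Fin n → ℝ) j = _
        ring
    rw [heq]
    obtain ⟨j, -, hj⟩ : ∃ j ∈ Finset.univ, 0 < (q₀ : Fin n → ℝ) j := by
      refine (Finset.sum_pos_iff_of_nonneg fun j _ => q₀.2.1 j).1 ?_
      rw [q₀.2.2]
      exact one_pos
    exact Finset.sum_pos' (fun j _ => mul_nonneg (q₀.2.1 j) (div_pos (hpA j) hs).le)
      ⟨j, Finset.mem_univ j, mul_pos hj (div_pos (hpA j) hs)⟩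

/-- The coordinate functionals of `ℝᵐ` together with the columns of an `m × n` matrix, given as a
vector of its entries, as functionals on `ℝᵐ`. -/
def gameFunctionals (x : Fin m × Fin n → ℝ) : Fin m ⊕ Fin n → Dual ℝ (Fin m → ℝ) :=
  Sum.elim (fun i => LinearMap.proj i) fun j => ∑ i, x (i, j) • LinearMap.proj i

@[simp]
theorem gameFunctionals_inl (x : Fin m × Fin n → ℝ) (i : Fin m) (p : Fin m → ℝ) :
    gameFunctionals x (Sum.inl i) p = p i := rfl

@[simp]
theorem gameFunctionals_inr (x : Fin m × Fin n → ℝ) (j : Fin n) (p : Fin m → ℝ) :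
    gameFunctionals x (Sum.inr j) p = ∑ i, x (i, j) * p i := by
  simp [gameFunctionals]

theorem continuous_gameFunctionals (k : Fin m ⊕ Fin n) (p : Fin m → ℝ) :
    Continuous fun x => gameFunctionals x k p := by
  rcases k with i | j
  · simpa using continuous_const
  · simp only [gameFunctionals_inr]
    fun_prop

/-- Changing signs of rows and columns of the matrix moves the region of a sign vector to the
region of the all-ones vector. -/
theorem one_mem_signPatterns_gameFunctionals_iff (s : Fin m ⊕ Fin n → ℤˣ)
    (x : Fin m × Fin n → ℝ) :
    1 ∈ signPatterns (gameFunctionals fun ij => (s (Sum.inl ij.1) * s (Sum.inr ij.2)) • x ij) ↔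
      s ∈ signPatterns (gameFunctionals x) := by
  have hrow : ∀ (p : Fin m → ℝ) (j : Fin n),
      ∑ i, ((s (Sum.inl i) * s (Sum.inr j)) • x (i, j)) * p i =
        s (Sum.inr j) • ∑ i, x (i, j) * (s (Sum.inl i) • p i) := fun p j => by
    rw [Finset.smul_sum]
    refine Finset.sum_congr rfl fun i _ => ?_
    simp only [Units.smul_def, zsmul_eq_mul, Units.val_mul, Int.cast_mul]
    ring
  simp only [signPatterns, Set.mem_ofPred_eq, Sum.forall, gameFunctionals_inl,
    gameFunctionals_inr, Pi.one_apply, one_smul, hrow]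
  constructor
  · rintro ⟨p, hp, hpA⟩
    refine ⟨fun i => s (Sum.inl i) • p i, fun i => ?_, hpA⟩
    rw [smul_smul, Int.units_mul_self, one_smul]
    exact hp i
  · rintro ⟨p, hp, hpA⟩
    refine ⟨fun i => s (Sum.inl i) • p i, hp, fun j => ?_⟩
    simpa only [smul_smul, Int.units_mul_self, one_smul] using hpA j

/-- A point annihilated by some of the coordinates and by as many columns as there are other
coordinates is annihilated by a square submatrix, whose determinant is almost surely nonzero. -/
theorem ae_inGeneralPosition_gameFunctionals :
    ∀ᵐ x : Fin m × Fin n → ℝ, InGeneralPosition (gameFunctionals x) := by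
  refine (ae_all_iff.2 fun S => ?_ : ∀ᵐ x : Fin m × Fin n → ℝ, ∀ S : Finset (Fin m ⊕ Fin n),
    S.card = _ → ∀ p, (∀ k ∈ S, gameFunctionals x k p = 0) → p = 0)
  by_cases hS : S.card = finrank ℝ (Fin m → ℝ)
  swap
  · exact Filter.Eventually.of_forall fun z h => absurd h hS
  have hcard : Fintype.card {i // i ∈ S.toLeftᶜ} = Fintype.card {j // j ∈ S.toRight} := by
    have := S.card_toLeft_add_card_toRight
    rw [hS, finrank_fin_fun] at this
    rw [Fintype.card_coe, Fintype.card_coe, Finset.card_compl, Fintype.card_fin]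
    omega
  let e : {i // i ∈ S.toLeftᶜ} ≃ {j // j ∈ S.toRight} := Fintype.equivOfCardEq hcard
  let L : (Fin m × Fin n → ℝ) →ₗ[ℝ] Matrix {i // i ∈ S.toLeftᶜ} {i // i ∈ S.toLeftᶜ} ℝ :=
    { toFun := fun x => Matrix.of fun j i => x (i, e j)
      map_add' := fun _ _ => rfl
      map_smul' := fun _ _ => rfl }
  -- The matrix whose square submatrix in question is the identity.
  let v : Fin m × Fin n → ℝ := fun ij =>
    if h : ij.1 ∈ S.toLeftᶜ then if (e ⟨ij.1, h⟩ : Fin n) = ij.2 then 1 else 0 else 0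
  have hv : L v = 1 := by
    ext j i
    change v (i, e j) = _
    simp only [v, dif_pos i.2, Subtype.coe_eta, Subtype.coe_inj, e.injective.eq_iff]
    rw [Matrix.one_apply]
    exact if_congr eq_comm rfl rfl
  filter_upwards [ae_det_ne_zero volume L (v := v) (by simp [hv])] with x hx _ p hp
  have hleft : ∀ i ∉ S.toLeftᶜ, p i = 0 := fun i hi => by
    simpa using hp (Sum.inl i) (by simpa using hi)
  have hright : (fun i : {i // i ∈ S.toLeftᶜ} => p i) = 0 := by
    refine Matrix.eq_zero_of_mulVec_eq_zero hx ?_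
    ext j
    have := hp (Sum.inr (e j)) (Finset.mem_toRight.1 (e j).2)
    rw [gameFunctionals_inr, ← Finset.sum_subset (Finset.subset_univ S.toLeftᶜ)
      fun i _ hi => by rw [hleft i hi, mul_zero], ← Finset.sum_coe_sort] at this
    exact this
  ext i
  by_cases hi : i ∈ S.toLeftᶜ
  · exact congrFun hright ⟨i, hi⟩
  · exact hleft i hi

theorem measureReal_gameValue_pos {Ω : Type*} [MeasurableSpace Ω] (P : Measure Ω)
    [IsProbabilityMeasure P] (hm : 0 < m) (hn : 0 < n) (a : Fin m → Fin n → Ω → ℝ)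
    (hindep : iIndepFun (fun ij : Fin m × Fin n => a ij.1 ij.2) P)
    (heven : ∀ i j, HasEvenDensity (a i j) P) :
    P.real {ω | 0 < gameValue (Matrix.of fun i j => a i j ω)} =
      (1 / 2 ^ (m + n - 1) : ℝ) * ∑ j ∈ Finset.range m, ((m + n - 1).choose j : ℝ) := by
  have : Nonempty (Fin m) := ⟨⟨0, hm⟩⟩
  have heven' : ∀ ij : Fin m × Fin n, HasEvenDensity (a ij.1 ij.2) P := fun ij => heven _ _
  have hZ : Measurable fun ω (ij : Fin m × Fin n) => a ij.1 ij.2 ω :=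
    measurable_pi_lambda _ fun ij => (heven' ij).1
  have := Measure.isProbabilityMeasure_map (μ := P) hZ.aemeasurable
  have key := measureReal_one_mem_signPatterns (by simp)
    (P.map fun ω (ij : Fin m × Fin n) => a ij.1 ij.2 ω) _ continuous_gameFunctionals
    ((absolutelyContinuous_map hindep heven').ae_le ae_inGeneralPosition_gameFunctionals) _
    (fun s => measurePreserving_units_smul hindep heven' _)
    one_mem_signPatterns_gameFunctionals_iff
  rw [finrank_fin_fun, Fintype.card_sum, Fintype.card_fin, Fintype.card_fin] at key
  rw [← key, map_measureReal_apply hZ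
    (isOpen_mem_signPatterns continuous_gameFunctionals 1).measurableSet]
  congr 1
  ext ω
  simp [gameValue_pos_iff hm hn, signPatterns, mul_comm]

end Game

/-- The first part evaluates the probability that a random game favors the row player. The second
part says that it is the probability that the convex hull of any `m + n` independent random points
of `ℝᵐ` with symmetric densities does not contain the origin. -/
theorem mainTheorem3 {m n : ℕ} (hm : 0 < m) (hn : 0 < n)
    {Ω : Type*} [MeasurableSpace Ω] (P : Measure Ω) [IsProbabilityMeasure P]
    (a : Fin m → Fin n → Ω → ℝ)
    (hindep : iIndepFun (fun ij : Fin m × Fin n => a ij.1 ij.2) P)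
    (heven : ∀ i j, HasEvenDensity (a i j) P) :
    P.real {ω | 0 < gameValue (Matrix.of fun i j => a i j ω)} =
        (1 / 2 ^ (m + n - 1) : ℝ) * ∑ j ∈ Finset.range m, ((m + n - 1).choose j : ℝ) ∧
    ∀ {Ω' : Type*} [MeasurableSpace Ω'] (P' : Measure Ω') [IsProbabilityMeasure P']
      (z : Fin (m + n) → Ω' → EuclideanSpace ℝ (Fin m)),
      iIndepFun z P' → (∀ k, HasEvenDensity (z k) P') →
      P.real {ω | 0 < gameValue (Matrix.of fun i j => a i j ω)} =
        P'.real {ω' | (0 : EuclideanSpace ℝ (Fin m)) ∉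
          convexHull ℝ (Set.range fun k => z k ω')} := by
  have hgame := measureReal_gameValue_pos P hm hn a hindep heven
  refine ⟨hgame, fun P' _ z hz hz' => ?_⟩
  have : Nonempty (Fin (m + n)) := ⟨⟨0, by omega⟩⟩
  rw [hgame, measureReal_zero_notMem_convexHull P' (by simp) z hz hz', Fintype.card_fin]
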